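/- Let $d\ge 2$ be an integer and let $\alpha>0$ be real. There is an integer $k\ge 1$, depending only on $d$ and $\alpha$, such that for every $\lambda>0$ the following holds. Let $X$ be a homogeneous Poisson process on $\mathbb{R}^d$ with density $\lambda$. For $x\in X$ let $d_i(x)$ denote the Euclidean distance from $x$ to its $i$-th nearest neighbour in $X$, and form the undirected graph $\mathrm{GN}_k(d,\alpha)$ with vertex set $X$ by joining each $x\in X$ by an edge to all other points $y\in X$ with $|x-y|\le r(x)$, where $r(x)=\alpha\, d_k(x)$. (This is the generalised nearest neighbour model with connection range $r(x)=\sum_{i\ge 1}\alpha_i d_i(x)$ in which $\alpha_k=\alpha$ and $\alpha_i=0$ for $i\neq k$.) Then $\mathrm{GN}_k(d,\alpha)$ percolates, i.e. almost surely this graph has an infinite connected component. -/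

import Mathlib

open MeasureTheory ProbabilityTheory
open scoped NNReal ENNReal

/-- `X` is a homogeneous Poisson process on `ℝ^d` with density `lam`, seen as a random set of
points: every realisation is locally finite, the number of points in a bounded Borel set `A` is
a random variable with the Poisson distribution of mean `lam * |A|`, and the numbers of points in
finitely many pairwise disjoint bounded Borel sets are independent. -/
structure IsHomogeneousPoissonProcess {Ω : Type*} [MeasurableSpace Ω] {d : ℕ}
    (X : Ω → Set (EuclideanSpace ℝ (Fin d))) (lam : ℝ≥0) (P : Measure Ω) : Prop where
  locallyFinite : ∀ (ω : Ω) (A : Set (EuclideanSpace ℝ (Fin d))),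
    Bornology.IsBounded A → (X ω ∩ A).Finite
  measurable_count : ∀ A : Set (EuclideanSpace ℝ (Fin d)), MeasurableSet A →
    Bornology.IsBounded A → Measurable (fun ω => (X ω ∩ A).ncard)
  hasLaw_count : ∀ A : Set (EuclideanSpace ℝ (Fin d)), MeasurableSet A →
    Bornology.IsBounded A →
      HasLaw (fun ω => (X ω ∩ A).ncard) (poissonMeasure (lam * (volume A).toNNReal)) P
  indep_count : ∀ (n : ℕ) (A : Fin n → Set (EuclideanSpace ℝ (Fin d))),
    (∀ i, MeasurableSet (A i)) → (∀ i, Bornology.IsBounded (A i)) →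
      Pairwise (fun i j => Disjoint (A i) (A j)) →
        iIndepFun (fun i ω => (X ω ∩ A i).ncard) P

/-- `nthNeighbourDist S i x` is `d_i(x)`, the Euclidean distance from `x` to its `i`-th nearest
neighbour in the point set `S`: the least `r` such that at least `i` points of `S` other than `x`
are within distance `r` of `x` (it is `∞` if `S` has fewer than `i` points other than `x`). -/
noncomputable def nthNeighbourDist {d : ℕ} (S : Set (EuclideanSpace ℝ (Fin d))) (i : ℕ)
    (x : EuclideanSpace ℝ (Fin d)) : ℝ≥0∞ :=
  sInf {r : ℝ≥0∞ | (i : ℕ∞) ≤ {y | y ∈ S ∧ y ≠ x ∧ edist x y ≤ r}.encard}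

/-- The connection range `r(x) = ∑_{i ≥ 1} α_i d_i(x)`. -/
noncomputable def connectionRange {d : ℕ} (S : Set (EuclideanSpace ℝ (Fin d))) (α : ℕ+ → ℝ≥0)
    (x : EuclideanSpace ℝ (Fin d)) : ℝ≥0∞ :=
  ∑' i : ℕ+, (α i : ℝ≥0∞) * nthNeighbourDist S i x

/-- The graph of the generalised nearest neighbour model on the point set `S`: every `x ∈ S` is
joined by an (undirected) edge to all other `y ∈ S` with `|x - y| ≤ r(x)`. -/
def gnGraph {d : ℕ} (S : Set (EuclideanSpace ℝ (Fin d))) (α : ℕ+ → ℝ≥0) : SimpleGraph S where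
  Adj x y := x ≠ y ∧
    (edist (x : EuclideanSpace ℝ (Fin d)) y ≤ connectionRange S α x ∨
      edist (x : EuclideanSpace ℝ (Fin d)) y ≤ connectionRange S α y)
  symm := ⟨fun x y h => ⟨h.1.symm, by rw [edist_comm]; exact h.2.symm⟩⟩
  loopless := ⟨fun _ h => h.1 rfl⟩

/-- The model `GN(d, α)` built on the random point set `X` percolates: almost surely its graph has
an infinite connected component. -/
def GNPercolates {Ω : Type*} [MeasurableSpace Ω] {d : ℕ}
    (X : Ω → Set (EuclideanSpace ℝ (Fin d))) (P : Measure Ω) (α : ℕ+ → ℝ≥0) : Prop :=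
  ∀ᵐ ω ∂P, ∃ c : (gnGraph (X ω) α).ConnectedComponent, c.supp.Infinite

/-! A planar layer of cubes of side `s` is indexed by `ℤ × ℤ`. A site is good if its cube holds a
point while the box reaching `L` cubes further holds at most `k`. A point in a good cube then has
its `k`-th neighbour at distance at least `s * L`; once `α * L ≥ 2 * d`, its range covers all
adjacent cubes, so an infinite cluster of good sites yields an infinite component
(`exists_infinite_component_of_infinite_cluster`).

Such a cluster exists by a Peierls argument. If all clusters were finite, planar duality
(`exists_reachable_compl_of_finite`) would give, for infinitely many `m`, a self-avoiding bad path
of `m + 1` sites from `(m, 0)`. There are at most `9 ^ m` of these, each bad with probability at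
most `18⁻¹ ^ m`, so Borel–Cantelli excludes this.

The parameters are chosen in the order `L`, mean `μ` per cube, `k`; the density only enters through
`s`, fixed by `lam * s ^ d = μ`. -/

/-! ### Planar duality by a parity argument. -/

/-- The king's graph on `ℤ × ℤ`, restricted to the sites of `s`. -/
def kingGraphOn (s : Set (ℤ × ℤ)) : SimpleGraph (ℤ × ℤ) where
  Adj u v := u ≠ v ∧ |u.1 - v.1| ≤ 1 ∧ |u.2 - v.2| ≤ 1 ∧ u ∈ s ∧ v ∈ s
  symm := ⟨fun u v h => ⟨h.1.symm, by rw [abs_sub_comm]; exact h.2.1,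
    by rw [abs_sub_comm]; exact h.2.2.1, h.2.2.2.2, h.2.2.2.1⟩⟩
  loopless := ⟨fun _ h => h.1 rfl⟩

/-- The indicator modulo two of an edge between `C` and `K`. -/
noncomputable def cutEdge (C K : Set (ℤ × ℤ)) (u v : ℤ × ℤ) : ZMod 2 :=
  C.indicator 1 u * K.indicator 1 v + C.indicator 1 v * K.indicator 1 u

theorem cutEdge_comm (C K : Set (ℤ × ℤ)) (u v : ℤ × ℤ) :
    cutEdge C K u v = cutEdge C K v u := add_comm _ _

theorem cutEdge_eq_zero_of_notMem {C K : Set (ℤ × ℤ)} {u v : ℤ × ℤ} (hu : u ∉ C) (hv : v ∉ C) :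
    cutEdge C K u v = 0 := by
  simp [cutEdge, hu, hv]

/-- Closedness of the cochain `cutEdge`: on a square meeting `C`, the vertices outside `C` are all
in `K` or all outside it, so there `cutEdge` is the coboundary of `0` or of the indicator of `C`. -/
theorem cutEdge_square {C K : Set (ℤ × ℤ)} {p₁ p₂ p₃ p₄ : ℤ × ℤ} (hKC : Disjoint K C)
    (h : ∀ c ∈ ({p₁, p₂, p₃, p₄} : Set (ℤ × ℤ)), ∀ u ∈ ({p₁, p₂, p₃, p₄} : Set (ℤ × ℤ)),
      ∀ v ∈ ({p₁, p₂, p₃, p₄} : Set (ℤ × ℤ)), c ∈ C → u ∉ C → v ∉ C → (u ∈ K → v ∈ K)) :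
    cutEdge C K p₁ p₂ + cutEdge C K p₂ p₃ + cutEdge C K p₃ p₄ + cutEdge C K p₄ p₁ = 0 := by
  classical
  by_cases hC : ∃ c ∈ ({p₁, p₂, p₃, p₄} : Set (ℤ × ℤ)), c ∈ C
  · obtain ⟨c, hc, hcC⟩ := hC
    have key : ∃ ε : ZMod 2, ∀ u ∈ ({p₁, p₂, p₃, p₄} : Set (ℤ × ℤ)),
        K.indicator (1 : ℤ × ℤ → ZMod 2) u = ε * (1 + C.indicator 1 u) := by
      by_cases hK : ∃ u ∈ ({p₁, p₂, p₃, p₄} : Set (ℤ × ℤ)), u ∈ K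
      · obtain ⟨u, hu, huK⟩ := hK
        refine ⟨1, fun v hv => ?_⟩
        by_cases hvC : v ∈ C
        · have : v ∉ K := fun hvK => Set.disjoint_left.1 hKC hvK hvC
          simp only [Set.indicator_of_mem hvC, Set.indicator_of_notMem this, Pi.one_apply]
          decide
        · have := h c hc u hu v hv hcC (Set.disjoint_left.1 hKC huK) hvC huK
          simp [hvC, this]
      · push Not at hK
        exact ⟨0, fun v hv => by simp [hK v hv]⟩
    obtain ⟨ε, hε⟩ := key
    have alg : ∀ ε a b c e : ZMod 2, a * (ε * (1 + b)) + b * (ε * (1 + a))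
        + (b * (ε * (1 + c)) + c * (ε * (1 + b))) + (c * (ε * (1 + e)) + e * (ε * (1 + c)))
        + (e * (ε * (1 + a)) + a * (ε * (1 + e))) = 0 := by decide
    simp only [cutEdge, hε p₁ (by simp), hε p₂ (by simp), hε p₃ (by simp), hε p₄ (by simp)]
    exact alg ε _ _ _ _
  · push Not at hC
    simp [cutEdge, hC p₁ (by simp), hC p₂ (by simp), hC p₃ (by simp), hC p₄ (by simp)]

/-- Sum of the square relation over a strip: interior vertical edges cancel. The sign `e` serves the
right and left half-rows alike. -/
theorem sum_cutEdge_row {C K : Set (ℤ × ℤ)} (hKC : Disjoint K C)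
    (h : ∀ c u v : ℤ × ℤ, |c.1 - u.1| ≤ 1 → |c.2 - u.2| ≤ 1 → |c.1 - v.1| ≤ 1 →
      |c.2 - v.2| ≤ 1 → |u.1 - v.1| ≤ 1 → |u.2 - v.2| ≤ 1 →
      c ∈ C → u ∉ C → v ∉ C → (u ∈ K → v ∈ K))
    (e : ℤ) (he : |e| ≤ 1) (y : ℤ) (M : ℕ) :
    ∑ i ∈ Finset.range M, cutEdge C K (e * i, y) (e * (i + 1), y)
      + ∑ i ∈ Finset.range M, cutEdge C K (e * i, y + 1) (e * (i + 1), y + 1)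
      = cutEdge C K (0, y) (0, y + 1) + cutEdge C K (e * M, y) (e * M, y + 1) := by
  have two : ∀ a : ZMod 2, a + a = 0 := by decide
  induction M with
  | zero => simp [two]
  | succ M ih =>
    rw [Finset.sum_range_succ, Finset.sum_range_succ]
    have sq := cutEdge_square (p₁ := (e * M, y)) (p₂ := (e * (M + 1), y))
      (p₃ := (e * (M + 1), y + 1)) (p₄ := (e * M, y + 1)) hKC (by
        have h1 : |e * M - e * (M + 1)| ≤ 1 := by
          rw [show e * M - e * (M + 1) = -e by ring, abs_neg]; exact he
        have h2 : |e * (M + 1) - e * M| ≤ 1 := by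
          rw [show e * (M + 1) - e * M = e by ring]; exact he
        intro c hc u hu v hv
        have close : ∀ p ∈ ({(e * M, y), (e * (M + 1), y), (e * (M + 1), y + 1),
            (e * M, y + 1)} : Set (ℤ × ℤ)), ∀ q ∈ ({(e * M, y), (e * (M + 1), y),
            (e * (M + 1), y + 1), (e * M, y + 1)} : Set (ℤ × ℤ)),
            |p.1 - q.1| ≤ 1 ∧ |p.2 - q.2| ≤ 1 := by
          intro p hp q hq
          simp only [Set.mem_insert_iff, Set.mem_singleton_iff] at hp hq
          rcases hp with rfl | rfl | rfl | rfl <;> rcases hq with rfl | rfl | rfl | rfl <;>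
            simp [h1, h2]
        exact h c u v (close c hc u hu).1 (close c hc u hu).2 (close c hc v hv).1
          (close c hc v hv).2 (close u hu v hv).1 (close u hu v hv).2)
    push_cast
    rw [cutEdge_comm C K (e * (M + 1), y + 1), cutEdge_comm C K (e * M, y + 1) (e * M, y)] at sq
    generalize cutEdge C K (e * M, y) (e * (M + 1), y) = a at *
    generalize cutEdge C K (e * M, y + 1) (e * (M + 1), y + 1) = b at *
    generalize cutEdge C K (e * M, y) (e * M, y + 1) = c at *
    generalize cutEdge C K (e * (M + 1), y) (e * (M + 1), y + 1) = f at *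
    generalize cutEdge C K (0, y) (0, y + 1) = g at *
    generalize ∑ i ∈ Finset.range M, cutEdge C K (e * i, y) (e * (i + 1), y) = s at *
    generalize ∑ i ∈ Finset.range M, cutEdge C K (e * i, y + 1) (e * (i + 1), y + 1) = t at *
    revert a b c f g s t
    decide

/-- If a finite set `C` contains the segment from `(0, 0)` to `(n, 0)` and its outer boundary avoids
`G`, then the complement of `G` connects the axis to the right of that segment with the axis to the
left of the origin. -/
theorem exists_reachable_compl_of_finite {G C : Set (ℤ × ℤ)} (hC : C.Finite) (n : ℕ)
    (hseg : ∀ i : ℕ, i ≤ n → ((i : ℤ), (0 : ℤ)) ∈ C)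
    (hbd : ∀ c ∈ C, ∀ v ∉ C, |c.1 - v.1| ≤ 1 → |c.2 - v.2| ≤ 1 → v ∉ G) :
    ∃ m j : ℕ, n < m ∧ 0 < j ∧
      (kingGraphOn Gᶜ).Reachable ((m : ℤ), (0 : ℤ)) (-(j : ℤ), (0 : ℤ)) := by
  classical
  have two : ∀ a : ZMod 2, a + a = 0 := by decide
  -- It suffices that `K` meets the negative axis. The sum of `cutEdge` over a whole row does not
  -- depend on the row and vanishes far up, while the right half of the axis contributes `1`; hence
  -- the left half contributes too.
  set K : Set (ℤ × ℤ) := {v | v ∉ C ∧ v ∈ Gᶜ ∧ ∃ m : ℕ, n < m ∧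
    (kingGraphOn Gᶜ).Reachable ((m : ℤ), (0 : ℤ)) v} with hK
  have hKC : Disjoint K C := Set.disjoint_left.2 fun v hv => hv.1
  have hcl : ∀ c u v : ℤ × ℤ, |c.1 - u.1| ≤ 1 → |c.2 - u.2| ≤ 1 → |c.1 - v.1| ≤ 1 →
      |c.2 - v.2| ≤ 1 → |u.1 - v.1| ≤ 1 → |u.2 - v.2| ≤ 1 →
      c ∈ C → u ∉ C → v ∉ C → (u ∈ K → v ∈ K) := by
    rintro c u v - - h3 h4 h5 h6 hc hu hv ⟨-, huG, m, hm, hr⟩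
    have hvG := hbd c hc v hv h3 h4
    refine ⟨hv, hvG, m, hm, ?_⟩
    by_cases huv : u = v
    · exact huv ▸ hr
    · exact hr.trans (SimpleGraph.Adj.reachable ⟨huv, h5, h6, huG, hvG⟩)
  obtain ⟨M, hM⟩ : ∃ M : ℕ, ∀ v ∈ C, |v.1| < M ∧ |v.2| < M := by
    obtain ⟨B, hB⟩ := (hC.image fun v : ℤ × ℤ => max |v.1| |v.2|).bddAbove
    refine ⟨B.toNat + 1, fun v hv => ?_⟩
    have := hB (Set.mem_image_of_mem _ hv)
    simp only [sup_le_iff] at this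
    push_cast
    omega
  have hfar : ∀ v : ℤ × ℤ, (M : ℤ) ≤ |v.1| ∨ (M : ℤ) ≤ |v.2| → v ∉ C := by
    intro v hv hvC
    have := hM v hvC
    omega
  set S : ℤ → ℤ → ZMod 2 := fun e y =>
    ∑ i ∈ Finset.range M, cutEdge C K (e * i, y) (e * (i + 1), y) with hS
  -- The vertical edge at column `0` occurs in both halves and cancels; those at columns `±M` miss
  -- `C`.
  have hstep : ∀ y, S 1 y + S (-1) y = S 1 (y + 1) + S (-1) (y + 1) := by
    intro y
    have h1 := sum_cutEdge_row hKC hcl 1 (by simp) y M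
    have h2 := sum_cutEdge_row hKC hcl (-1) (by simp) y M
    rw [cutEdge_eq_zero_of_notMem (u := (1 * (M : ℤ), y)) (hfar _ (by simp))
      (hfar _ (by simp))] at h1
    rw [cutEdge_eq_zero_of_notMem (u := (-1 * (M : ℤ), y)) (hfar _ (by simp))
      (hfar _ (by simp))] at h2
    change S 1 y + S 1 (y + 1) = _ at h1
    change S (-1) y + S (-1) (y + 1) = _ at h2
    generalize S 1 y = a at *
    generalize S 1 (y + 1) = b at *
    generalize S (-1) y = c at *
    generalize S (-1) (y + 1) = f at *
    generalize cutEdge C K (0, y) (0, y + 1) = g at *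
    revert a b c f g
    decide
  have hconst : ∀ y : ℕ, S 1 0 + S (-1) 0 = S 1 y + S (-1) y := by
    intro y
    induction y with
    | zero => rfl
    | succ y ih => rw [ih, hstep]; push_cast; rfl
  have htop : ∀ e, S e M = 0 := fun e => Finset.sum_eq_zero fun i _ =>
    cutEdge_eq_zero_of_notMem (hfar _ (by simp)) (hfar _ (by simp))
  -- Right of the origin, an axis site outside `C` but next to it lies beyond the segment and avoids
  -- `G`, so the trivial walk puts it in `K`.
  have haxis : ∀ i : ℕ, (∃ c ∈ C, |c.1 - (i : ℤ)| ≤ 1 ∧ |c.2| ≤ 1) →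
      K.indicator (1 : ℤ × ℤ → ZMod 2) ((i : ℤ), (0 : ℤ))
        = 1 + C.indicator (1 : ℤ × ℤ → ZMod 2) ((i : ℤ), (0 : ℤ)) := by
    rintro i ⟨c, hc, h1, h2⟩
    by_cases hi : ((i : ℤ), (0 : ℤ)) ∈ C
    · rw [Set.indicator_of_mem hi, Set.indicator_of_notMem (Set.disjoint_right.1 hKC hi)]
      exact (two 1).symm
    · have hin : n < i := by
        by_contra hle
        exact hi (hseg i (by omega))
      have : ((i : ℤ), (0 : ℤ)) ∈ K :=
        ⟨hi, hbd c hc _ hi h1 (by simpa using h2), i, hin, SimpleGraph.Reachable.refl _⟩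
      rw [Set.indicator_of_notMem hi, Set.indicator_of_mem this]
      exact (add_zero 1).symm
  have hright : ∀ N : ℕ, ∑ i ∈ Finset.range N, cutEdge C K (1 * i, 0) (1 * (i + 1), 0)
      = C.indicator 1 ((0 : ℤ), (0 : ℤ)) + C.indicator 1 ((N : ℤ), (0 : ℤ)) := by
    intro N
    induction N with
    | zero => simp [two]
    | succ N ih =>
      rw [Finset.sum_range_succ, ih, one_mul, one_mul]
      have hE : cutEdge C K ((N : ℤ), (0 : ℤ)) ((N : ℤ) + 1, 0)
          = C.indicator 1 ((N : ℤ), (0 : ℤ)) + C.indicator 1 (((N + 1 : ℕ) : ℤ), (0 : ℤ)) := by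
        by_cases hE : ((N : ℤ), (0 : ℤ)) ∉ C ∧ (((N + 1 : ℕ) : ℤ), (0 : ℤ)) ∉ C
        · rw [cutEdge_eq_zero_of_notMem hE.1 (by simpa using hE.2)]
          rw [Set.indicator_of_notMem hE.1, Set.indicator_of_notMem hE.2, add_zero]
        · have hc : ∃ c ∈ C, c = ((N : ℤ), (0 : ℤ)) ∨ c = (((N + 1 : ℕ) : ℤ), (0 : ℤ)) := by
            by_contra hcon
            push Not at hcon
            exact hE ⟨fun h => (hcon _ h).1 rfl, fun h => (hcon _ h).2 rfl⟩
          obtain ⟨c, hc, hc'⟩ := hc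
          have k1 := haxis N ⟨c, hc, by rcases hc' with rfl | rfl <;> simp⟩
          have k2 := haxis (N + 1) ⟨c, hc, by rcases hc' with rfl | rfl <;> simp⟩
          rw [cutEdge, ← Nat.cast_succ, Nat.succ_eq_add_one, k1, k2]
          generalize C.indicator (1 : ℤ × ℤ → ZMod 2) ((N : ℤ), (0 : ℤ)) = a
          generalize C.indicator (1 : ℤ × ℤ → ZMod 2) (((N + 1 : ℕ) : ℤ), (0 : ℤ)) = b
          revert a b
          decide
      rw [hE]
      generalize C.indicator (1 : ℤ × ℤ → ZMod 2) ((N : ℤ), (0 : ℤ)) = a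
      linear_combination two a
  have h0 : ((0 : ℤ), (0 : ℤ)) ∈ C := by simpa using hseg 0 (Nat.zero_le n)
  have hS1 : S 1 0 = 1 := by
    rw [hS]
    change ∑ i ∈ Finset.range M, cutEdge C K (1 * i, 0) (1 * (i + 1), 0) = 1
    rw [hright M, Set.indicator_of_mem h0, Set.indicator_of_notMem (hfar _ (by simp))]
    simp
  have hS2 : S (-1) 0 ≠ 0 := by
    intro h
    have := hconst M
    rw [htop, htop, hS1, h] at this
    exact absurd this (by decide)
  obtain ⟨i, -, hi⟩ := Finset.exists_ne_zero_of_sum_ne_zero hS2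
  have hmem : ∃ j : ℕ, (-(j : ℤ), (0 : ℤ)) ∈ K := by
    by_contra hcon
    push Not at hcon
    apply hi
    have h1 := hcon i
    have h2 := hcon (i + 1)
    rw [show (-1 : ℤ) * i = -(i : ℤ) by ring,
      show (-1 : ℤ) * (i + 1) = -((i + 1 : ℕ) : ℤ) by push_cast; ring]
    simp only [cutEdge, Set.indicator_of_notMem h1, Set.indicator_of_notMem h2, mul_zero, add_zero]
  obtain ⟨j, hj⟩ := hmem
  obtain ⟨m, hm, hr⟩ := hj.2.2
  refine ⟨m, j, hm, Nat.pos_of_ne_zero ?_, hr⟩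
  rintro rfl
  exact hj.1 (by simpa using h0)

theorem exists_reachable_compl_of_forall_finite {G : Set (ℤ × ℤ)}
    (hG : ∀ u, {v | (kingGraphOn G).Reachable u v}.Finite) (n : ℕ) :
    ∃ m j : ℕ, n < m ∧ 0 < j ∧
      (kingGraphOn Gᶜ).Reachable ((m : ℤ), (0 : ℤ)) (-(j : ℤ), (0 : ℤ)) := by
  set N : Set (ℤ × ℤ) := Set.Icc (-1) (n + 1 : ℤ) ×ˢ Set.Icc (-1) 1 with hN
  have hNfin : N.Finite := (Set.finite_Icc _ _).prod (Set.finite_Icc _ _)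
  -- The segment alone may have neighbours in `G`; adding the clusters of those neighbours absorbs
  -- them.
  refine exists_reachable_compl_of_finite (G := G)
    (C := (fun i : ℕ => ((i : ℤ), (0 : ℤ))) '' Set.Iic n ∪
      ⋃ u ∈ N ∩ G, {v | (kingGraphOn G).Reachable u v})
    (((Set.finite_Iic n).image _).union
      ((hNfin.subset Set.inter_subset_left).biUnion fun u _ => hG u)) n
    (fun i hi => Or.inl ⟨i, hi, rfl⟩) ?_
  intro c hc v hv h1 h2 hvG
  apply hv
  right
  simp only [Set.mem_iUnion, Set.mem_ofPred_eq]
  rcases hc with ⟨i, hi, rfl⟩ | hc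
  · refine ⟨v, ⟨?_, hvG⟩, SimpleGraph.Reachable.refl _⟩
    simp only [Set.mem_Iic] at hi
    simp only [abs_le] at h1 h2
    simp only [hN, Set.mem_prod, Set.mem_Icc]
    omega
  · simp only [Set.mem_iUnion, Set.mem_ofPred_eq] at hc
    obtain ⟨u, ⟨huN, huG⟩, hr⟩ := hc
    refine ⟨u, ⟨huN, huG⟩, ?_⟩
    by_cases hcv : c = v
    · exact hcv ▸ hr
    · have hcG : c ∈ G := by
        by_cases huc : u = c
        · exact huc ▸ huG
        · obtain ⟨w⟩ := hr.symm
          cases w with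
          | nil => exact huG
          | cons h _ => exact h.2.2.2.1
      exact hr.trans (SimpleGraph.Adj.reachable ⟨hcv, h1, h2, hcG, hvG⟩)

/-! ### Counting self-avoiding bad paths. -/

/-- The sequences of `m + 1` sites that start at `v` and make steps of the king's graph,
standing still allowed. -/
noncomputable def kingPaths : ℕ → ℤ × ℤ → Finset (List (ℤ × ℤ))
  | 0, v => {[v]}
  | m + 1, v => (Finset.Icc (v.1 - 1) (v.1 + 1) ×ˢ Finset.Icc (v.2 - 1) (v.2 + 1)).biUnion
      fun w => (kingPaths m w).image (v :: ·)

theorem card_kingPaths_le (m : ℕ) (v : ℤ × ℤ) : (kingPaths m v).card ≤ 9 ^ m := by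
  induction m generalizing v with
  | zero => simp [kingPaths]
  | succ m ih =>
    rw [kingPaths]
    refine (Finset.card_biUnion_le_card_mul _ _ (9 ^ m)
      fun w _ => Finset.card_image_le.trans (ih w)).trans ?_
    rw [Finset.card_product, Int.card_Icc, Int.card_Icc, pow_succ, mul_comm]
    refine Nat.mul_le_mul_left _ ?_
    rw [show v.1 + 1 + 1 - (v.1 - 1) = 3 by ring, show v.2 + 1 + 1 - (v.2 - 1) = 3 by ring]
    decide

theorem length_of_mem_kingPaths {m : ℕ} {v : ℤ × ℤ} {l : List (ℤ × ℤ)} (hl : l ∈ kingPaths m v) :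
    l.length = m + 1 := by
  induction m generalizing v l with
  | zero => simp [kingPaths] at hl; simp [hl]
  | succ m ih =>
    simp only [kingPaths, Finset.mem_biUnion, Finset.mem_image] at hl
    obtain ⟨w, -, l', hl', rfl⟩ := hl
    simp [ih hl']

theorem take_support_mem_kingPaths {s : Set (ℤ × ℤ)} {u v : ℤ × ℤ} (p : (kingGraphOn s).Walk u v)
    (m : ℕ) (hm : m ≤ p.length) : p.support.take (m + 1) ∈ kingPaths m u := by
  induction p generalizing m with
  | nil => obtain rfl : m = 0 := by simpa using hm
           simp [kingPaths]
  | @cons u w v h p ih =>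
    cases m with
    | zero => simp [kingPaths]
    | succ m =>
      rw [SimpleGraph.Walk.support_cons, List.take_succ_cons, kingPaths, Finset.mem_biUnion]
      refine ⟨w, ?_, Finset.mem_image_of_mem _ (ih m (by simpa using hm))⟩
      have h1 := abs_le.1 h.2.1
      have h2 := abs_le.1 h.2.2.1
      simp only [Finset.mem_product, Finset.mem_Icc]
      omega

theorem abs_sub_le_length {s : Set (ℤ × ℤ)} {u v : ℤ × ℤ} (p : (kingGraphOn s).Walk u v) :
    |u.1 - v.1| ≤ p.length := by
  induction p with
  | nil => simp
  | @cons u w v h p ih =>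
    have := abs_sub_le u.1 w.1 v.1
    have := h.2.1
    rw [SimpleGraph.Walk.length_cons]
    push_cast
    omega

theorem support_subset {s : Set (ℤ × ℤ)} {u v : ℤ × ℤ} (p : (kingGraphOn s).Walk u v)
    (hu : u ∈ s) : ∀ z ∈ p.support, z ∈ s := by
  induction p with
  | nil => simpa using hu
  | cons h p ih =>
    intro z hz
    rw [SimpleGraph.Walk.support_cons, List.mem_cons] at hz
    rcases hz with rfl | hz
    · exact hu
    · exact ih h.2.2.2.2 z hz

theorem exists_nodup_kingPath {s : Set (ℤ × ℤ)} {u v : ℤ × ℤ} {m : ℕ}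
    (h : (kingGraphOn s).Reachable u v) (hm : m < |u.1 - v.1|) :
    ∃ l ∈ kingPaths m u, l.Nodup ∧ ∀ z ∈ l, z ∈ s := by
  classical
  obtain ⟨p, hp⟩ := h.exists_isPath
  have hlen := abs_sub_le_length p
  have hu : u ∈ s := by
    cases p with
    | nil => simp at hm; omega
    | cons h _ => exact h.2.2.2.1
  exact ⟨_, take_support_mem_kingPaths p m (by omega), hp.support_nodup.sublist
    (List.take_sublist _ _), fun z hz => support_subset p hu z (List.mem_of_mem_take hz)⟩

/-- If every cluster of `G` is finite, then for infinitely many `m` there is a self-avoiding path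
of length `m` outside `G` starting at `(m, 0)`. -/
theorem frequently_exists_kingPath_of_forall_finite {G : Set (ℤ × ℤ)}
    (hG : ∀ u, {v | (kingGraphOn G).Reachable u v}.Finite) :
    ∃ᶠ m : ℕ in Filter.atTop,
      ∃ l ∈ kingPaths m ((m : ℤ), (0 : ℤ)), l.Nodup ∧ ∀ z ∈ l, z ∉ G := by
  rw [Filter.frequently_atTop]
  intro n
  obtain ⟨m, j, hm, hj, hr⟩ := exists_reachable_compl_of_forall_finite hG n
  refine ⟨m, hm.le, exists_nodup_kingPath hr ?_⟩
  change (m : ℤ) < |(m : ℤ) - -(j : ℤ)|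
  rw [abs_of_nonneg (by omega)]
  omega

/-! ### Geometry of cubes and boxes. -/

/-- The site `z` of the planar lattice as a point of the lattice `ℤ^d`. -/
def planeCoord {d : ℕ} (z : ℤ × ℤ) (i : Fin d) : ℤ :=
  if i.val = 0 then z.1 else if i.val = 1 then z.2 else 0

/-- The half-open box made of the cubes of side `s` that are at most `L` cubes away from the cube
with index `z`. -/
def planeBox (d : ℕ) (s : ℝ) (L : ℕ) (z : ℤ × ℤ) : Set (EuclideanSpace ℝ (Fin d)) :=
  {x | ∀ i, s * (planeCoord z i - L) ≤ x i ∧ x i < s * (planeCoord z i + L + 1)}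

theorem planeBox_eq_preimage (d : ℕ) (s : ℝ) (L : ℕ) (z : ℤ × ℤ) :
    planeBox d s L z = WithLp.ofLp ⁻¹' Set.univ.pi fun i : Fin d =>
      Set.Ico (s * (planeCoord z i - L)) (s * (planeCoord z i + L + 1)) := by
  ext x
  simp [planeBox]

theorem measurableSet_planeBox (d : ℕ) (s : ℝ) (L : ℕ) (z : ℤ × ℤ) :
    MeasurableSet (planeBox d s L z) := by
  rw [planeBox_eq_preimage]
  exact (PiLp.volume_preserving_ofLp (Fin d)).measurable
    (MeasurableSet.univ_pi fun _ => measurableSet_Ico)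

theorem volume_planeBox (d : ℕ) (s : ℝ) (L : ℕ) (z : ℤ × ℤ) :
    volume (planeBox d s L z) = ENNReal.ofReal (s * (2 * L + 1)) ^ d := by
  rw [planeBox_eq_preimage, (PiLp.volume_preserving_ofLp (Fin d)).measure_preimage
    (MeasurableSet.univ_pi fun _ => measurableSet_Ico).nullMeasurableSet, Real.volume_pi_Ico]
  rw [Finset.prod_congr rfl fun i _ => by
    rw [show s * (planeCoord z i + L + 1) - s * (planeCoord z i - L) = s * (2 * L + 1) by ring]]
  simp

theorem EuclideanSpace.dist_le_card_mul {d : ℕ} {x y : EuclideanSpace ℝ (Fin d)} {t : ℝ}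
    (h : ∀ i, |x i - y i| ≤ t) : dist x y ≤ d * t := by
  rcases Nat.eq_zero_or_pos d with rfl | hd
  · simp [Subsingleton.elim x y]
  have ht : 0 ≤ t := (abs_nonneg _).trans (h ⟨0, hd⟩)
  have hd1 : (1 : ℝ) ≤ d := by exact_mod_cast hd
  rw [EuclideanSpace.dist_eq]
  refine Real.sqrt_le_iff.2 ⟨by positivity, ?_⟩
  calc ∑ i, dist (x i) (y i) ^ 2 ≤ ∑ _i : Fin d, t ^ 2 :=
        Finset.sum_le_sum fun i _ => pow_le_pow_left₀ dist_nonneg (h i) 2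
    _ = d * t ^ 2 := by simp
    _ ≤ d * (d * t ^ 2) := le_mul_of_one_le_left (by positivity) hd1
    _ = (d * t) ^ 2 := by ring

theorem isBounded_planeBox (d : ℕ) (s : ℝ) (L : ℕ) (z : ℤ × ℤ) :
    Bornology.IsBounded (planeBox d s L z) := by
  refine Metric.isBounded_iff.2 ⟨d * (s * (2 * L + 1)), fun x hx y hy => ?_⟩
  refine EuclideanSpace.dist_le_card_mul fun i => abs_le.2 ?_
  have := hx i
  have := hy i
  constructor <;> linarith

theorem planeBox_zero_subset {d : ℕ} {s : ℝ} (hs : 0 < s) (L : ℕ) (z : ℤ × ℤ) :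
    planeBox d s 0 z ⊆ planeBox d s L z := by
  intro x hx i
  have h := hx i
  have : 0 ≤ s * L := by positivity
  simp only [Nat.cast_zero] at h
  constructor <;> linarith

theorem mem_planeBox_of_abs_sub_le {d : ℕ} {s : ℝ} {L : ℕ} {z : ℤ × ℤ}
    {x y : EuclideanSpace ℝ (Fin d)} (hx : x ∈ planeBox d s 0 z)
    (h : ∀ i, |x i - y i| ≤ s * L) : y ∈ planeBox d s L z := by
  intro i
  have h1 := hx i
  have h2 := abs_le.1 (h i)
  simp only [Nat.cast_zero] at h1
  constructor <;> linarith

theorem disjoint_planeBox {d : ℕ} (hd : 2 ≤ d) {s : ℝ} (hs : 0 < s) {L : ℕ} {z w : ℤ × ℤ}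
    (hzw : 2 * (L : ℤ) + 1 ≤ |z.1 - w.1| ∨ 2 * (L : ℤ) + 1 ≤ |z.2 - w.2|) :
    Disjoint (planeBox d s L z) (planeBox d s L w) := by
  have aux : ∀ a b : ℤ, ∀ t : ℝ, s * (a - L) ≤ t → t < s * (a + L + 1) → s * (b - L) ≤ t →
      t < s * (b + L + 1) → |a - b| < 2 * (L : ℤ) + 1 := by
    intro a b t h1 h2 h3 h4
    have h5 : (a : ℝ) - L < b + L + 1 := lt_of_mul_lt_mul_left (h1.trans_lt h4) hs.le
    have h6 : (b : ℝ) - L < a + L + 1 := lt_of_mul_lt_mul_left (h3.trans_lt h2) hs.le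
    have h7 : a - L < b + L + 1 := by exact_mod_cast h5
    have h8 : b - L < a + L + 1 := by exact_mod_cast h6
    rw [abs_lt]
    omega
  refine Set.disjoint_left.2 fun x hz hw => ?_
  rcases hzw with h | h
  · have h1 := hz ⟨0, by omega⟩
    have h2 := hw ⟨0, by omega⟩
    simp only [planeCoord, if_true] at h1 h2
    exact absurd h (not_le.2 (aux _ _ _ h1.1 h1.2 h2.1 h2.2))
  · have h1 := hz ⟨1, by omega⟩
    have h2 := hw ⟨1, by omega⟩
    simp only [planeCoord, one_ne_zero, if_true, if_false] at h1 h2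
    exact absurd h (not_le.2 (aux _ _ _ h1.1 h1.2 h2.1 h2.2))

theorem abs_sub_le_of_mem_planeBox {d : ℕ} {s : ℝ} (hs : 0 < s) {z w : ℤ × ℤ}
    (h1 : |z.1 - w.1| ≤ 1) (h2 : |z.2 - w.2| ≤ 1) {x y : EuclideanSpace ℝ (Fin d)}
    (hx : x ∈ planeBox d s 0 z) (hy : y ∈ planeBox d s 0 w) (i : Fin d) :
    |x i - y i| ≤ 2 * s := by
  have hc : |(planeCoord z i : ℤ) - planeCoord w i| ≤ 1 := by
    unfold planeCoord
    split_ifs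
    · exact h1
    · exact h2
    · simp
  have hc' : |(planeCoord z i : ℝ) - planeCoord w i| ≤ 1 := by exact_mod_cast hc
  have hx' := hx i
  have hy' := hy i
  simp only [Nat.cast_zero] at hx' hy'
  rw [abs_le] at hc' ⊢
  have e1 := mul_le_mul_of_nonneg_left hc'.1 hs.le
  have e2 := mul_le_mul_of_nonneg_left hc'.2 hs.le
  constructor <;> nlinarith

/-! ### From good clusters to components of the graph. -/

/-- The sites whose cube contains a point of `S` and whose box contains at most `k` points. -/
def goodSites {d : ℕ} (S : Set (EuclideanSpace ℝ (Fin d))) (s : ℝ) (L k : ℕ) : Set (ℤ × ℤ) :=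
  {z | (S ∩ planeBox d s 0 z).Nonempty ∧ (S ∩ planeBox d s L z).ncard ≤ k}

theorem le_connectionRange_of_mem_goodSites {d : ℕ} {S : Set (EuclideanSpace ℝ (Fin d))}
    (hS : ∀ A, Bornology.IsBounded A → (S ∩ A).Finite) {s : ℝ} (hs : 0 < s) {L : ℕ} {k : ℕ+}
    (α : ℝ≥0) {z : ℤ × ℤ} (hz : z ∈ goodSites S s L k) {x : EuclideanSpace ℝ (Fin d)}
    (hxS : x ∈ S) (hx : x ∈ planeBox d s 0 z) :
    (α : ℝ≥0∞) * ENNReal.ofReal (s * L) ≤ connectionRange S (Pi.single k α) x := by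
  have h1 : ENNReal.ofReal (s * L) ≤ nthNeighbourDist S k x := by
    refine le_sInf fun r hr => ?_
    by_contra hlt
    have hfin := hS _ (isBounded_planeBox d s L z)
    have hsub : {y | y ∈ S ∧ y ≠ x ∧ edist x y ≤ r} ⊆ (S ∩ planeBox d s L z) \ {x} := by
      rintro y ⟨hyS, hyx, hy⟩
      refine ⟨⟨hyS, mem_planeBox_of_abs_sub_le hx fun i => ?_⟩, hyx⟩
      have hxy : edist x y ≤ ENNReal.ofReal (s * L) := hy.trans (not_le.1 hlt).le
      rw [edist_dist, ENNReal.ofReal_le_ofReal_iff (by positivity)] at hxy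
      exact (PiLp.norm_apply_le (x - y) i).trans ((dist_eq_norm x y).symm.trans_le hxy)
    have hr' : ((k : ℕ) : ℕ∞) ≤ ((S ∩ planeBox d s L z) \ {x}).encard :=
      le_trans hr (Set.encard_le_encard hsub)
    rw [← (hfin.subset Set.sdiff_subset).cast_ncard_eq, Nat.cast_le] at hr'
    -- The point `x` itself is one of the at most `k` points in the box, leaving fewer than `k`
    -- possible neighbours.
    have := Set.ncard_sdiff_singleton_lt_of_mem
      (show x ∈ S ∩ planeBox d s L z from ⟨hxS, planeBox_zero_subset hs L z hx⟩) hfin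
    have := hz.2
    omega
  calc (α : ℝ≥0∞) * ENNReal.ofReal (s * L)
      ≤ ((Pi.single k α : ℕ+ → ℝ≥0) k : ℝ≥0∞) * nthNeighbourDist S k x := by
        rw [Pi.single_eq_same]; gcongr
    _ ≤ _ := ENNReal.le_tsum k

theorem exists_infinite_component_of_infinite_cluster {d : ℕ} (hd : 2 ≤ d)
    {S : Set (EuclideanSpace ℝ (Fin d))}
    (hS : ∀ A, Bornology.IsBounded A → (S ∩ A).Finite) {s : ℝ} (hs : 0 < s) {L : ℕ} {k : ℕ+}
    {α : ℝ≥0} (hL : 2 * (d : ℝ) ≤ α * L) {u : ℤ × ℤ}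
    (hu : {v | (kingGraphOn (goodSites S s L k)).Reachable u v}.Infinite) :
    ∃ c : (gnGraph S (Pi.single k α)).ConnectedComponent, c.supp.Infinite := by
  classical
  set G := goodSites S s L k with hG
  have huG : u ∈ G := by
    obtain ⟨v, hv, hvu⟩ := hu.exists_notMem_finite (Set.finite_singleton u)
    obtain ⟨w⟩ := (show (kingGraphOn G).Reachable u v from hv)
    cases w with
    | nil => simp at hvu
    | cons h _ => exact h.2.2.2.1
  -- One point per good cube; disjointness of the cubes makes the choice injective.
  choose! f hf using fun (z : ℤ × ℤ) (hz : z ∈ G) => hz.1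
  let g : G → S := fun z => ⟨f z, (hf z z.2).1⟩
  have hne : ∀ z w : G, z ≠ w → g z ≠ g w := by
    intro z w hzw h
    have hfe : f z = f w := congrArg Subtype.val h
    have hdisj : Disjoint (planeBox d s 0 (z : ℤ × ℤ)) (planeBox d s 0 (w : ℤ × ℤ)) := by
      refine disjoint_planeBox hd hs ?_
      by_contra hcon
      push Not at hcon
      refine hzw (Subtype.ext (Prod.ext ?_ ?_))
      · have := abs_lt.1 hcon.1
        push_cast at this
        omega
      · have := abs_lt.1 hcon.2
        push_cast at this
        omega
    exact Set.disjoint_left.1 hdisj (hf z z.2).2 (hfe ▸ (hf w w.2).2)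
  have hadj : ∀ z w : G, (kingGraphOn G).Adj z w → (gnGraph S (Pi.single k α)).Adj (g z) (g w) := by
    intro z w h
    refine ⟨hne z w fun e => h.1 (congrArg Subtype.val e), Or.inl ?_⟩
    refine le_trans ?_ (le_connectionRange_of_mem_goodSites hS hs α z.2 (hf z z.2).1 (hf z z.2).2)
    rw [edist_dist, ← ENNReal.ofReal_coe_nnreal, ← ENNReal.ofReal_mul α.coe_nonneg]
    refine ENNReal.ofReal_le_ofReal ?_
    refine (EuclideanSpace.dist_le_card_mul
      (abs_sub_le_of_mem_planeBox hs h.2.1 h.2.2.1 (hf z z.2).2 (hf w w.2).2)).trans ?_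
    nlinarith
  have hreach : ∀ (v w : ℤ × ℤ) (hv : v ∈ G) (_ : (kingGraphOn G).Walk v w), ∃ hw : w ∈ G,
      (gnGraph S (Pi.single k α)).Reachable (g ⟨v, hv⟩) (g ⟨w, hw⟩) := by
    intro v w hv p
    induction p with
    | nil => exact ⟨hv, SimpleGraph.Reachable.refl _⟩
    | cons h p ih =>
      obtain ⟨hw, hr⟩ := ih h.2.2.2.2
      exact ⟨hw, (hadj ⟨_, hv⟩ ⟨_, h.2.2.2.2⟩ h).reachable.trans hr⟩
  refine ⟨(gnGraph S (Pi.single k α)).connectedComponentMk (g ⟨u, huG⟩), ?_⟩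
  have hsub : {v | (kingGraphOn G).Reachable u v} ⊆ Subtype.val '' (g ⁻¹'
      ((gnGraph S (Pi.single k α)).connectedComponentMk (g ⟨u, huG⟩)).supp) := by
    rintro v ⟨p⟩
    obtain ⟨hv, hr⟩ := hreach u v huG p
    exact ⟨⟨v, hv⟩, SimpleGraph.ConnectedComponent.sound hr.symm, rfl⟩
  intro hfin
  refine hu (Set.Finite.subset (Set.Finite.image _ (hfin.preimage ?_)) hsub)
  intro z _ w _ h
  by_contra hzw
  exact hne z w hzw h

/-! ### Probability estimates. -/

/-- The probability bound for a site not to be good, when cubes contain `μ` points on average. -/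
noncomputable def badProb (μ : ℝ≥0) (L d k : ℕ) : ℝ≥0∞ :=
  poissonMeasure μ {0} + poissonMeasure (μ * (2 * L + 1) ^ d) (Set.Ioi k)

/-- A large `μ` makes an empty cube unlikely; with `μ` fixed, a large `k` makes an overfull box
unlikely. -/
theorem exists_badProb_le (L d : ℕ) {ε : ℝ≥0∞} (hε : 0 < ε) :
    ∃ μ : ℝ≥0, 0 < μ ∧ ∃ k : ℕ+, badProb μ L d k ≤ ε := by
  have hε2 : 0 < ε / 2 := ENNReal.half_pos hε.ne'
  obtain ⟨μ, hμ, hμ0⟩ : ∃ μ : ℝ≥0, poissonMeasure μ {0} ≤ ε / 2 ∧ 0 < μ := by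
    have h1 : Filter.Tendsto (fun n : ℕ => poissonMeasure (n : ℝ≥0) {0}) Filter.atTop (nhds 0) := by
      simp only [poissonMeasure_singleton]
      rw [← ENNReal.ofReal_zero]
      refine ENNReal.tendsto_ofReal ?_
      refine (Real.tendsto_exp_neg_atTop_nhds_zero.comp tendsto_natCast_atTop_atTop).congr
        fun n => ?_
      simp
    obtain ⟨n, hn, hn0⟩ := ((h1.eventually (ge_mem_nhds hε2)).and
      (Filter.eventually_gt_atTop 0)).exists
    exact ⟨n, hn, by exact_mod_cast hn0⟩
  have h2 : Filter.Tendsto (fun k : ℕ => poissonMeasure (μ * (2 * L + 1) ^ d) (Set.Ioi k))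
      Filter.atTop (nhds 0) := by
    have := tendsto_measure_iInter_atTop (μ := poissonMeasure (μ * (2 * L + 1) ^ d))
      (s := fun k : ℕ => Set.Ioi k) (fun _ => MeasurableSet.of_discrete.nullMeasurableSet)
      (fun a b hab => Set.Ioi_subset_Ioi hab) ⟨0, measure_ne_top _ _⟩
    have he : ⋂ n : ℕ, Set.Ioi n = ∅ := by
      ext x
      simp only [Set.mem_iInter, Set.mem_Ioi, Set.mem_empty_iff_false, iff_false, not_forall]
      exact ⟨x, lt_irrefl x⟩
    rwa [he, measure_empty] at this
  obtain ⟨k, hk, hk0⟩ := ((h2.eventually (ge_mem_nhds hε2)).and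
    (Filter.eventually_gt_atTop 0)).exists
  exact ⟨μ, hμ0, ⟨k, hk0⟩, (add_le_add hμ hk).trans (ENNReal.add_halves ε).le⟩

section

variable {Ω : Type*} [MeasurableSpace Ω] {P : Measure Ω} {d : ℕ} {lam : ℝ≥0}
  {X : Ω → Set (EuclideanSpace ℝ (Fin d))}

/-- Goodness involves two nested counts, but independence is given for one count per disjoint set.
So a union bound runs over the kind of failure `τ i` at each site; each `τ` gives a product, and the
sum of the products factorises. -/
theorem measure_forall_notMem_goodSites_le (hX : IsHomogeneousPoissonProcess X lam P)
    {s : ℝ} (hs : 0 < s) {L k : ℕ} {μ : ℝ≥0} (hμ : (lam : ℝ) * s ^ d = μ) {n : ℕ}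
    (z : Fin n → ℤ × ℤ)
    (hz : Pairwise fun i j => Disjoint (planeBox d s L (z i)) (planeBox d s L (z j))) :
    P {ω | ∀ i, z i ∉ goodSites (X ω) s L k} ≤ badProb μ L d k ^ n := by
  classical
  -- `true` stands for an empty cube, `false` for an overfull box.
  let R : Bool → ℕ := fun b => if b then 0 else L
  let D : Bool → Set ℕ := fun b => if b then {0} else Set.Ioi k
  let q : Bool → ℝ≥0∞ := fun b => poissonMeasure (μ * (2 * R b + 1) ^ d) (D b)
  have hsub : ∀ b z, planeBox d s (R b) z ⊆ planeBox d s L z := by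
    intro b z
    cases b
    · exact le_rfl
    · exact planeBox_zero_subset hs L z
  have hcover : {ω | ∀ i, z i ∉ goodSites (X ω) s L k} ⊆ ⋃ τ : Fin n → Bool,
      ⋂ i ∈ (Finset.univ : Finset (Fin n)),
        (fun ω => (X ω ∩ planeBox d s (R (τ i)) (z i)).ncard) ⁻¹' D (τ i) := by
    intro ω hω
    have : ∀ i, ∃ b, (X ω ∩ planeBox d s (R b) (z i)).ncard ∈ D b := by
      intro i
      by_cases h : (X ω ∩ planeBox d s 0 (z i)).Nonempty
      · refine ⟨false, ?_⟩
        change k < (X ω ∩ planeBox d s L (z i)).ncard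
        exact not_le.1 fun hk => hω i ⟨h, hk⟩
      · refine ⟨true, ?_⟩
        change (X ω ∩ planeBox d s 0 (z i)).ncard = 0
        rw [Set.not_nonempty_iff_eq_empty.1 h, Set.ncard_empty]
    choose τ hτ using this
    simp only [Set.mem_iUnion, Set.mem_iInter]
    exact ⟨τ, fun i _ => hτ i⟩
  have hlaw : ∀ (b : Bool) (w : ℤ × ℤ),
      P ((fun ω => (X ω ∩ planeBox d s (R b) w).ncard) ⁻¹' D b) = q b := by
    intro b w
    have h := (hX.hasLaw_count _ (measurableSet_planeBox d s (R b) w)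
      (isBounded_planeBox d s (R b) w)).measure_eq (p := (· ∈ D b)) MeasurableSet.of_discrete
    refine h.trans ?_
    have hvol : lam * (volume (planeBox d s (R b) w)).toNNReal = μ * (2 * R b + 1) ^ d := by
      rw [volume_planeBox, ENNReal.toNNReal_pow]
      apply NNReal.coe_injective
      push_cast
      rw [← hμ]
      rw [ENNReal.toReal_ofReal (by positivity), mul_pow, mul_assoc]
    rw [hvol]
    rfl
  have hτ : ∀ τ : Fin n → Bool, P (⋂ i ∈ (Finset.univ : Finset (Fin n)),
      (fun ω => (X ω ∩ planeBox d s (R (τ i)) (z i)).ncard) ⁻¹' D (τ i)) = ∏ i, q (τ i) := by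
    intro τ
    rw [(hX.indep_count n (fun i => planeBox d s (R (τ i)) (z i))
      (fun i => measurableSet_planeBox _ _ _ _) (fun i => isBounded_planeBox _ _ _ _)
      fun i j hij => (hz hij).mono (hsub _ _) (hsub _ _)).measure_inter_preimage_eq_mul
      Finset.univ fun i _ => MeasurableSet.of_discrete]
    exact Finset.prod_congr rfl fun i _ => hlaw _ _
  calc P {ω | ∀ i, z i ∉ goodSites (X ω) s L k}
      ≤ ∑ τ : Fin n → Bool, ∏ i, q (τ i) :=
        (measure_mono hcover).trans ((measure_iUnion_fintype_le P _).trans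
          (Finset.sum_le_sum fun τ _ => (hτ τ).le))
    _ = ∏ _i : Fin n, ∑ b, q b := by
        rw [Finset.prod_univ_sum, Fintype.piFinset_univ]
    _ = badProb μ L d k ^ n := by
        simp [q, R, D, badProb]

/-- Pigeonhole over the `W ^ 2` residue classes modulo `W`; with `W = 2 * L + 1` the boxes of one
class are disjoint. -/
theorem exists_residue_class_card_le (W : ℕ) [NeZero W] (T : Finset (ℤ × ℤ)) :
    ∃ U ⊆ T, T.card ≤ W ^ 2 * U.card ∧
      ∀ z ∈ U, ∀ w ∈ U, z ≠ w → (W : ℤ) ≤ |z.1 - w.1| ∨ (W : ℤ) ≤ |z.2 - w.2| := by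
  classical
  let f : ℤ × ℤ → ZMod W × ZMod W := fun z => (z.1, z.2)
  obtain ⟨y, -, hy⟩ : ∃ y ∈ (Finset.univ : Finset (ZMod W × ZMod W)),
      (T.card : ℚ) / W ^ 2 ≤ ((T.filter fun z => f z = y).card : ℚ) := by
    refine Finset.exists_le_card_fiber_of_nsmul_le_card_of_maps_to
      (fun _ _ => Finset.mem_univ _) Finset.univ_nonempty ?_
    have hW : (W : ℚ) ≠ 0 := Nat.cast_ne_zero.2 (NeZero.ne W)
    rw [Finset.card_univ, Fintype.card_prod, ZMod.card, nsmul_eq_mul]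
    push_cast
    apply le_of_eq
    field_simp
  have hW : (0 : ℚ) < W := Nat.cast_pos.2 (NeZero.pos W)
  refine ⟨T.filter fun z => f z = y, Finset.filter_subset _ _, ?_, ?_⟩
  · rw [div_le_iff₀ (by positivity)] at hy
    rw [mul_comm]
    exact_mod_cast hy
  · intro z hz w hw hzw
    have hfe : f z = f w := (Finset.mem_filter.1 hz).2.trans (Finset.mem_filter.1 hw).2.symm
    have key : ∀ a b : ℤ, (a : ZMod W) = b → a ≠ b → (W : ℤ) ≤ |a - b| := by
      intro a b hab hne
      have hdvd : (W : ℤ) ∣ a - b := by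
        rw [← ZMod.intCast_zmod_eq_zero_iff_dvd]
        push_cast
        rw [hab, sub_self]
      exact Int.le_of_dvd (abs_pos.2 (sub_ne_zero.2 hne)) ((dvd_abs _ _).2 hdvd)
    by_cases h1 : z.1 = w.1
    · exact Or.inr (key _ _ (congrArg Prod.snd hfe) fun h2 => hzw (Prod.ext h1 h2))
    · exact Or.inl (key _ _ (congrArg Prod.fst hfe) h1)

/-- The exponent in `hq` pays for keeping a single residue class of `T`. -/
theorem measure_forall_mem_notMem_goodSites_le (hd : 2 ≤ d)
    (hX : IsHomogeneousPoissonProcess X lam P) {s : ℝ} (hs : 0 < s) {L k : ℕ} {μ : ℝ≥0}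
    (hμ : (lam : ℝ) * s ^ d = μ) {ε : ℝ≥0∞} (hε : ε ≤ 1)
    (hq : badProb μ L d k ≤ ε ^ ((2 * L + 1) ^ 2)) (T : Finset (ℤ × ℤ)) :
    P {ω | ∀ z ∈ T, z ∉ goodSites (X ω) s L k} ≤ ε ^ T.card := by
  obtain ⟨U, hUT, hcard, hU⟩ := exists_residue_class_card_le (2 * L + 1) T
  let e := U.equivFin.symm
  calc P {ω | ∀ z ∈ T, z ∉ goodSites (X ω) s L k}
      ≤ P {ω | ∀ i, (e i : ℤ × ℤ) ∉ goodSites (X ω) s L k} :=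
        measure_mono fun ω hω i => hω _ (hUT (e i).2)
    _ ≤ badProb μ L d k ^ U.card := by
        refine measure_forall_notMem_goodSites_le hX hs hμ (fun i => (e i : ℤ × ℤ)) ?_
        intro i j hij
        refine disjoint_planeBox hd hs ?_
        have := hU _ (e i).2 _ (e j).2 fun h => hij (e.injective (Subtype.ext h))
        push_cast at this
        exact this
    _ ≤ (ε ^ ((2 * L + 1) ^ 2)) ^ U.card := by gcongr
    _ = ε ^ ((2 * L + 1) ^ 2 * U.card) := (pow_mul _ _ _).symm
    _ ≤ ε ^ T.card := pow_le_pow_right_of_le_one' hε hcard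

theorem measure_exists_kingPath_le (hd : 2 ≤ d)
    (hX : IsHomogeneousPoissonProcess X lam P) {s : ℝ} (hs : 0 < s) {L k : ℕ} {μ : ℝ≥0}
    (hμ : (lam : ℝ) * s ^ d = μ) {ε : ℝ≥0∞} (hε : ε ≤ 1)
    (hq : badProb μ L d k ≤ ε ^ ((2 * L + 1) ^ 2)) (m : ℕ) (v : ℤ × ℤ) :
    P {ω | ∃ l ∈ kingPaths m v, l.Nodup ∧ ∀ z ∈ l, z ∉ goodSites (X ω) s L k} ≤ (9 * ε) ^ m := by
  classical
  have hcover : {ω | ∃ l ∈ kingPaths m v, l.Nodup ∧ ∀ z ∈ l, z ∉ goodSites (X ω) s L k} ⊆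
      ⋃ l ∈ (kingPaths m v).filter List.Nodup,
        {ω | ∀ z ∈ l.toFinset, z ∉ goodSites (X ω) s L k} := by
    rintro ω ⟨l, hl, hnd, hbad⟩
    simp only [Set.mem_iUnion]
    exact ⟨l, Finset.mem_filter.2 ⟨hl, hnd⟩, fun z hz => hbad z (List.mem_toFinset.1 hz)⟩
  calc _ ≤ ∑ l ∈ (kingPaths m v).filter List.Nodup,
        P {ω | ∀ z ∈ l.toFinset, z ∉ goodSites (X ω) s L k} :=
        (measure_mono hcover).trans (measure_biUnion_finset_le _ _)
    _ ≤ ∑ _l ∈ (kingPaths m v).filter List.Nodup, ε ^ m := by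
        refine Finset.sum_le_sum fun l hl => ?_
        obtain ⟨hl, hnd⟩ := Finset.mem_filter.1 hl
        refine (measure_forall_mem_notMem_goodSites_le hd hX hs hμ hε hq _).trans ?_
        rw [List.toFinset_card_of_nodup hnd, length_of_mem_kingPaths hl]
        exact pow_le_pow_right_of_le_one' hε (Nat.le_succ m)
    _ = ((kingPaths m v).filter List.Nodup).card * ε ^ m := by
        rw [Finset.sum_const, nsmul_eq_mul]
    _ ≤ (9 ^ m : ℕ) * ε ^ m := by
        gcongr
        exact (Finset.card_filter_le _ _).trans (card_kingPaths_le m v)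
    _ = (9 * ε) ^ m := by push_cast; rw [mul_pow]

/-- Almost surely some cluster of good sites is infinite, if sites are good with high enough
probability. -/
theorem ae_exists_infinite_cluster (hd : 2 ≤ d)
    (hX : IsHomogeneousPoissonProcess X lam P) {s : ℝ} (hs : 0 < s) {L k : ℕ} {μ : ℝ≥0}
    (hμ : (lam : ℝ) * s ^ d = μ) (hq : badProb μ L d k ≤ (18⁻¹ : ℝ≥0∞) ^ ((2 * L + 1) ^ 2)) :
    ∀ᵐ ω ∂P, ∃ u, {v | (kingGraphOn (goodSites (X ω) s L k)).Reachable u v}.Infinite := by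
  have hε : (18⁻¹ : ℝ≥0∞) ≤ 1 := ENNReal.inv_le_one.2 (by norm_num)
  -- Any `ε < 9⁻¹` would make the series converge; `18⁻¹` gives ratio `2⁻¹`.
  have h9 : (9 : ℝ≥0∞) * 18⁻¹ = 2⁻¹ := by
    rw [show (18 : ℝ≥0∞) = 9 * 2 by norm_num, ENNReal.mul_inv (by simp) (by simp), ← mul_assoc,
      ENNReal.mul_inv_cancel (by simp) (by simp), one_mul]
  have hsum : ∑' m : ℕ, P {ω | ∃ l ∈ kingPaths m ((m : ℤ), (0 : ℤ)), l.Nodup ∧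
      ∀ z ∈ l, z ∉ goodSites (X ω) s L k} ≠ ∞ := by
    refine ne_top_of_le_ne_top ?_ (ENNReal.tsum_le_tsum fun m =>
      measure_exists_kingPath_le hd hX hs hμ hε hq m _)
    rw [h9, ENNReal.tsum_geometric_two]
    exact ENNReal.ofNat_ne_top
  refine measure_mono_null (fun ω hω => ?_) (measure_setOfPred_frequently_eq_zero hsum)
  refine frequently_exists_kingPath_of_forall_finite fun u => ?_
  by_contra hu
  exact hω ⟨u, hu⟩

end

/-! ### Choice of parameters. -/

theorem mainTheorem4 (d : ℕ) (hd : 2 ≤ d) (α : ℝ≥0) (hα : 0 < α) :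
    ∃ k : ℕ+, ∀ (lam : ℝ≥0), 0 < lam →
      ∀ (Ω : Type*) [MeasurableSpace Ω] (P : Measure Ω) [IsProbabilityMeasure P]
        (X : Ω → Set (EuclideanSpace ℝ (Fin d))),
        IsHomogeneousPoissonProcess X lam P → GNPercolates X P (Pi.single k α) := by
  have hα' : (0 : ℝ) < α := hα
  obtain ⟨L, hL⟩ := exists_nat_ge (2 * (d : ℝ) / α)
  rw [div_le_iff₀ hα', mul_comm (L : ℝ)] at hL
  obtain ⟨μ, hμ, k, hk⟩ := exists_badProb_le L d
    (ENNReal.pow_pos (ENNReal.inv_pos.2 (ENNReal.ofNat_ne_top (n := 18))) ((2 * L + 1) ^ 2))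
  refine ⟨k, fun lam hlam Ω _ P _ X hX => ?_⟩
  have hpos : (0 : ℝ) < μ / lam := div_pos hμ hlam
  -- Scaling the cubes to mean `μ` points each makes `k` independent of the density.
  set s : ℝ := ((μ : ℝ) / lam) ^ ((d : ℝ)⁻¹) with hs_def
  have hs : 0 < s := Real.rpow_pos_of_pos hpos _
  have hsd : (lam : ℝ) * s ^ d = μ := by
    rw [hs_def, Real.rpow_inv_natCast_pow hpos.le (by omega),
      mul_div_cancel₀ _ (NNReal.coe_ne_zero.2 hlam.ne')]
  filter_upwards [ae_exists_infinite_cluster hd hX hs hsd hk] with ω ⟨u, hu⟩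
  exact exists_infinite_component_of_infinite_cluster hd (hX.locallyFinite ω) hs hL hu
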